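/- Let $\gamma>0$. A function $f:\mathbb R\to\mathbb C$ belongs to $C_p^0(\mathbb R)$ if it has finitely many discontinuities on every bounded interval and is integrable over every bounded interval; recursively, $f\in C_p^{l+1}(\mathbb R)$ if $f$ is continuous and, off a set with finitely many points in every bounded interval, differentiable with derivative equal to a function in $C_p^{l}(\mathbb R)$. $C^l_{p,\gamma}(\mathbb R)$ is the set of $\gamma$-periodic functions in $C_p^l(\mathbb R)$. Let $W:\mathbb R\to\mathbb C$ be continuous and $\gamma$-periodic, let $V\in C^0_{p,\gamma}(\mathbb R)$ be complex valued, and for $\lambda\in\mathbb R$ consider $$\mathscr L\psi:=-\psi''+W\psi'+V\psi=\lambda\psi ,\qquad \psi\in C_p^2(\mathbb R),$$ the equation being required at every point where the coefficients are continuous. For $k\in\mathbb C$ put $[k]_\gamma:=\{k+\frac{2m\pi}{\gamma}: m\in\mathbb Z\}\in\mathbb C/\frac{2\pi}{\gamma}\mathbb Z$. Consider the following forms of a solution $\psi$, in which all functions $p,p_1,p_2$ are in $C^2_{p,\gamma}(\mathbb R)$: (i) $\psi(x)=e^{\mathrm i k_0x}p(x)$; (ii) $\psi(x)=e^{\mathrm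 i k_0x}(p_1(x)+xp_2(x))$ with $p_2\not\equiv0$; (iii) $\psi(x)=e^{\mathrm i k_1x}p_1(x)+e^{\mathrm i k_2x}p_2(x)$ with $[k_1]_\gamma\ne[k_2]_\gamma$. The quasimomenta of $\psi$ are the numbers $k_0$ in representations (i) with $p\not\equiv0$ and (ii), and $k_1,k_2$ in representations (iii) with $p_1\not\equiv0$, $p_2\not\equiv0$. Let $\mathcal A(\lambda)$ be the set of the classes $[k]_\gamma$ of all quasimomenta $k$ of solutions of $\mathscr L\psi=\lambda\psi$. Let $\sigma_g^1(\mathscr L)$ (respectively $\sigma_g^2(\mathscr L)$) be the set of $\lambda\in\mathbb R$ for which there is a solution $\psi\not\equiv0$ of form (i) (respectively (ii)) with $\mathcal A(\lambda)=\{[k_0]_\gamma\}$, and let $\sigma_g^3(\mathscr L)$ be the set of $\lambda\in\mathbb R$ for which there is a solution $\psi\not\equiv0$ of form (iii) with $\mathcal A(\lambda)=\{[k_1]_\gamma,[k_2]_\gamma\}$. Let $\bar W=\frac1\gamma\int_0^\gamma W(s)\,ds$. **Theorem.** If $\lambda\in\sigma_g^1(\mathscr L)\cup\sigma_g^2(\mathscr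 L)$, then $$\mathcal A(\lambda)=\Big\{\Big[\tfrac{1}{2\mathrm i}\bar W\Big]_\gamma\Big\}\quad\text{or}\quad \mathcal A(\lambda)=\Big\{\Big[\tfrac{1}{2\mathrm i}\bar W+\tfrac{\pi}{\gamma}\Big]_\gamma\Big\}.$$ If $\lambda\in\sigma_g^3(\mathscr L)$, then there are $k_1,k_2\in\mathbb C$ with $[k_1]_\gamma\neq[k_2]_\gamma$ such that $$\mathcal A(\lambda)=\{[k_1]_\gamma,[k_2]_\gamma\},\qquad [k_1+k_2]_\gamma=\Big[\tfrac1{\mathrm i}\bar W\Big]_\gamma .$$ -/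

import Mathlib

namespace PeriodicSL

/-- `S` has only finitely many points in every bounded interval. -/
def FiniteOnIntervals (S : Set ℝ) : Prop :=
  ∀ a b : ℝ, (S ∩ Set.Icc a b).Finite

/-- The classes `C_p^l(ℝ)` of complex-valued functions.
`C_p^0`: piecewise continuous (finitely many discontinuities on every bounded interval) and
integrable over every bounded interval.
`C_p^(l+1)`: continuous functions whose derivative belongs to `C_p^l`. The derivative of a function
with piecewise continuous derivative need not exist at the (locally finitely many) discontinuities
of that derivative. (If `1 ≤ l`, then `g` is continuous, so that `f` is differentiable with
derivative `g` at every point, and the exceptional set `S` plays no role.) -/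
def IsCp : ℕ → (ℝ → ℂ) → Prop
  | 0, f => MeasureTheory.LocallyIntegrable f MeasureTheory.volume ∧
      FiniteOnIntervals {x | ¬ ContinuousAt f x}
  | l + 1, f => Continuous f ∧ ∃ g : ℝ → ℂ, IsCp l g ∧
      ∃ S : Set ℝ, FiniteOnIntervals S ∧ ∀ x, x ∉ S → HasDerivAt f (g x) x

/-- The classes `C_{p,γ}^l(ℝ)`: functions in `C_p^l(ℝ)` with period `γ`. -/
def IsCpPer (γ : ℝ) (l : ℕ) (f : ℝ → ℂ) : Prop :=
  IsCp l f ∧ Function.Periodic f γ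

/-- The quotient `ℂ / (2π/γ)ℤ`. -/
abbrev ClassSpace (γ : ℝ) : Type :=
  ℂ ⧸ AddSubgroup.zmultiples ((2 * Real.pi / γ : ℝ) : ℂ)

/-- The congruence class `[k]_γ = {k + 2mπ/γ : m ∈ ℤ}`. -/
noncomputable def kClass (γ : ℝ) (k : ℂ) : ClassSpace γ :=
  QuotientAddGroup.mk k

/-- The Sturm-Liouville expression `ℒψ = -ψ'' + W ψ' + V ψ`. -/
noncomputable def slOp (W V : ℝ → ℂ) (ψ : ℝ → ℂ) (x : ℝ) : ℂ :=
  -deriv (deriv ψ) x + W x * deriv ψ x + V x * ψ x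

/-- `ψ ∈ C_p^2(ℝ)` is a solution of `ℒψ = λψ`: the second derivative exists and the equation
holds at every point where both coefficients are continuous, that is, at all points but finitely
many on every bounded interval. -/
def IsSolution (W V : ℝ → ℂ) (lam : ℝ) (ψ : ℝ → ℂ) : Prop :=
  IsCp 2 ψ ∧ ∀ x : ℝ, ContinuousAt W x → ContinuousAt V x →
    DifferentiableAt ℝ (deriv ψ) x ∧ slOp W V ψ x = (lam : ℂ) * ψ x

/-- The plane wave `e^{ikx}`. -/
noncomputable def planeWave (k : ℂ) (x : ℝ) : ℂ :=
  Complex.exp (Complex.I * k * (x : ℂ))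

/-- `ψ = e^{ikx} p(x)` with `p ∈ C_{p,γ}^2`. -/
def BlochForm (γ : ℝ) (k : ℂ) (p ψ : ℝ → ℂ) : Prop :=
  IsCpPer γ 2 p ∧ ∀ x : ℝ, ψ x = planeWave k x * p x

/-- `ψ = e^{ikx} (p₁(x) + x p₂(x))` with `p₁, p₂ ∈ C_{p,γ}^2` and `p₂ ≢ 0`. -/
def GrowthForm (γ : ℝ) (k : ℂ) (p₁ p₂ ψ : ℝ → ℂ) : Prop :=
  IsCpPer γ 2 p₁ ∧ IsCpPer γ 2 p₂ ∧ p₂ ≠ 0 ∧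
    ∀ x : ℝ, ψ x = planeWave k x * (p₁ x + (x : ℂ) * p₂ x)

/-- `ψ = e^{ik₁x} p₁(x) + e^{ik₂x} p₂(x)` with `p₁, p₂ ∈ C_{p,γ}^2` and `[k₁]_γ ≠ [k₂]_γ`. -/
def CombForm (γ : ℝ) (k₁ k₂ : ℂ) (p₁ p₂ ψ : ℝ → ℂ) : Prop :=
  kClass γ k₁ ≠ kClass γ k₂ ∧ IsCpPer γ 2 p₁ ∧ IsCpPer γ 2 p₂ ∧
    ∀ x : ℝ, ψ x = planeWave k₁ x * p₁ x + planeWave k₂ x * p₂ x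

/-- `k` is a quasimomentum of `ψ`: it is an exponent that really occurs (with a non-zero periodic
factor) in a representation of `ψ` in one of the three forms. In the third form both exponents
are quasimomenta; since that form is symmetric in its two terms, it suffices to list `k` first. -/
def IsQuasimomentum (γ : ℝ) (ψ : ℝ → ℂ) (k : ℂ) : Prop :=
  (∃ p, p ≠ 0 ∧ BlochForm γ k p ψ) ∨
  (∃ p₁ p₂, GrowthForm γ k p₁ p₂ ψ) ∨
  (∃ k' p₁ p₂, p₁ ≠ 0 ∧ p₂ ≠ 0 ∧ CombForm γ k k' p₁ p₂ ψ)

/-- `𝒜(λ)`: the set of the congruence classes modulo `2π/γ` of the quasimomenta of the solutions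
of `ℒψ = λψ`. -/
def quasiClasses (γ : ℝ) (W V : ℝ → ℂ) (lam : ℝ) : Set (ClassSpace γ) :=
  {c | ∃ (ψ : ℝ → ℂ) (k : ℂ), IsSolution W V lam ψ ∧ IsQuasimomentum γ ψ k ∧ c = kClass γ k}

/-- `σ_g^1(ℒ)`: there is a non-trivial solution `e^{ik₀x} p(x)`, where `𝒜(λ) = {[k₀]_γ}`. -/
def sigma1 (γ : ℝ) (W V : ℝ → ℂ) : Set ℝ :=
  {lam | ∃ ψ : ℝ → ℂ, IsSolution W V lam ψ ∧ ψ ≠ 0 ∧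
    ∃ k₀ : ℂ, quasiClasses γ W V lam = {kClass γ k₀} ∧ ∃ p, BlochForm γ k₀ p ψ}

/-- `σ_g^2(ℒ)`: there is a solution `e^{ik₀x} (p₁(x) + x p₂(x))`, `p₂ ≢ 0`, where
`𝒜(λ) = {[k₀]_γ}`. -/
def sigma2 (γ : ℝ) (W V : ℝ → ℂ) : Set ℝ :=
  {lam | ∃ ψ : ℝ → ℂ, IsSolution W V lam ψ ∧ ψ ≠ 0 ∧
    ∃ k₀ : ℂ, quasiClasses γ W V lam = {kClass γ k₀} ∧ ∃ p₁ p₂, GrowthForm γ k₀ p₁ p₂ ψ}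

/-- `σ_g^3(ℒ)`: there is a non-trivial solution `e^{ik₁x} p₁(x) + e^{ik₂x} p₂(x)`, where
`[k₁]_γ ≠ [k₂]_γ` and `𝒜(λ) = {[k₁]_γ, [k₂]_γ}`. -/
def sigma3 (γ : ℝ) (W V : ℝ → ℂ) : Set ℝ :=
  {lam | ∃ ψ : ℝ → ℂ, IsSolution W V lam ψ ∧ ψ ≠ 0 ∧
    ∃ k₁ k₂ : ℂ, quasiClasses γ W V lam = {kClass γ k₁, kClass γ k₂} ∧
      ∃ p₁ p₂, CombForm γ k₁ k₂ p₁ p₂ ψ}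

/-- The mean `(1/γ) ∫₀^γ W(s) ds` of `W` over one period. -/
noncomputable def periodMean (γ : ℝ) (W : ℝ → ℂ) : ℂ :=
  (1 / (γ : ℂ)) * ∫ s in (0 : ℝ)..γ, W s

end PeriodicSL

namespace PeriodicSL

open MeasureTheory Set
open scoped BoundedContinuousFunction

/-! Floquet theory. Translation by `γ` acts on the two-dimensional solution space; a quasimomentum
class `[k]` is the same datum as an eigenvalue `ρ = e^{ikγ}` of this monodromy map (`kClass_eq_iff`,
`mem_quasiClasses_iff`). The eigenvalues are the roots of `ρ² - tρ + d`, where `d` is a Wronskian at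
`γ`, hence `d = exp ∫₀^γ W` by Liouville's formula (`wronskian_eq`, `exists_isMultiplier_iff`).

If `𝒜(λ)` is a single class, the root is double and `ρ² = d = (e^{iκγ})²` with `κ = W̄/(2i)`, so `ρ
= ±e^{iκγ}`; the sign `-1 = e^{i(π/γ)γ}` accounts for the shift by `π/γ`. If there are two classes,
the product of the roots is `d`, which says `[k₁ + k₂] = [W̄/i]`.

The coefficient `V` is only piecewise continuous and possibly unbounded, so a fundamental system is
built by a weighted Picard iteration (`exists_linear_ode_solution`), and uniqueness is deduced from
Wronskians. -/

theorem intervalIntegrable_of_locallyIntegrable {E : Type*} [NormedAddCommGroup E]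
    {f : ℝ → E} (hf : LocallyIntegrable f) (a b : ℝ) : IntervalIntegrable f volume a b :=
  (hf.integrableOn_isCompact isCompact_uIcc).intervalIntegrable

theorem locallyIntegrable_norm {E : Type*} [NormedAddCommGroup E]
    {f : ℝ → E} (hf : LocallyIntegrable f) : LocallyIntegrable fun x => ‖f x‖ :=
  hf.mono hf.aestronglyMeasurable.norm (Filter.Eventually.of_forall fun x => by simp)

theorem hasDerivAt_integral_of_locallyIntegrable {E : Type*} [NormedAddCommGroup E]
    [NormedSpace ℝ E] [CompleteSpace E] {f : ℝ → E} (hf : LocallyIntegrable f) (a : ℝ) {x : ℝ}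
    (hx : ContinuousAt f x) : HasDerivAt (fun y => ∫ s in a..y, f s) (f x) x :=
  intervalIntegral.integral_hasDerivAt_right
    (intervalIntegrable_of_locallyIntegrable hf _ _)
    (hf.aestronglyMeasurable.stronglyMeasurableAtFilter) hx

theorem continuous_integral_of_locallyIntegrable {E : Type*} [NormedAddCommGroup E]
    [NormedSpace ℝ E] {f : ℝ → E} (hf : LocallyIntegrable f) (a : ℝ) :
    Continuous fun y => ∫ s in a..y, f s :=
  intervalIntegral.continuous_primitive (fun _ _ => intervalIntegrable_of_locallyIntegrable hf _ _) a

/-! ### Global existence for linear systems with locally integrable coefficients. -/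

section LinearODE

variable {E : Type*} [NormedAddCommGroup E] [NormedSpace ℝ E]

/-- The weight `cosh (2 ∫₀ˣ ‖A‖)`, in which the Picard operator of `u' = A u` is contracting. -/
noncomputable def picardWeight (A : ℝ → E →L[ℝ] E) (x : ℝ) : ℝ :=
  Real.cosh (2 * ∫ s in (0 : ℝ)..x, ‖A s‖)

variable {A : ℝ → E →L[ℝ] E}

theorem one_le_picardWeight (x : ℝ) : 1 ≤ picardWeight A x := Real.one_le_cosh _

theorem picardWeight_pos (x : ℝ) : 0 < picardWeight A x :=
  zero_lt_one.trans_le (one_le_picardWeight x)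

theorem continuous_picardWeight (hA : LocallyIntegrable A) : Continuous (picardWeight A) :=
  Real.continuous_cosh.comp
    (continuous_const.mul (continuous_integral_of_locallyIntegrable (locallyIntegrable_norm hA) 0))

theorem locallyIntegrable_clm_apply (hA : LocallyIntegrable A) {u : ℝ → E} (hu : Continuous u) :
    LocallyIntegrable fun s => A s (u s) := by
  intro x
  obtain ⟨U, hU, hAU⟩ := hA x
  obtain ⟨K, hK, hxK, hKU⟩ : ∃ K ⊆ U, K ∈ nhds x ∧ IsCompact K := by
    obtain ⟨K, h1, h2, h3⟩ := local_compact_nhds hU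
    exact ⟨K, h2, h1, h3⟩
  refine ⟨K, hxK, ?_⟩
  have hAK : IntegrableOn A K := hAU.mono_set hK
  obtain ⟨C, hC⟩ := hKU.exists_bound_of_continuousOn hu.continuousOn
  refine Integrable.mono' (hAK.norm.mul_const C) ?_ ?_
  · exact (ContinuousLinearMap.id ℝ (E →L[ℝ] E)).aestronglyMeasurable_comp₂
      hAK.aestronglyMeasurable (hu.aestronglyMeasurable)
  · refine (ae_restrict_iff' hKU.measurableSet).2 (Filter.Eventually.of_forall fun s hs => ?_)
    exact (A s).le_opNorm_of_le (hC s hs)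

theorem integral_norm_mul_picardWeight (hA : LocallyIntegrable A) {D : Set ℝ} (hD : D.Countable)
    (hAD : ∀ x ∉ D, ContinuousAt A x) (x : ℝ) :
    ∫ s in (0 : ℝ)..x, ‖A s‖ * picardWeight A s =
      Real.sinh (2 * ∫ s in (0 : ℝ)..x, ‖A s‖) / 2 := by
  have hc := continuous_integral_of_locallyIntegrable (locallyIntegrable_norm hA) 0
  have := MeasureTheory.integral_eq_of_hasDerivAt_off_countable
    (fun y => Real.sinh (2 * ∫ s in (0 : ℝ)..y, ‖A s‖) / 2)
    (fun s => ‖A s‖ * picardWeight A s) (a := 0) (b := x) hD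
    ((Real.continuous_sinh.comp (continuous_const.mul hc)).div_const 2).continuousOn
    (fun y hy => by
      have h := (((hasDerivAt_integral_of_locallyIntegrable (locallyIntegrable_norm hA) 0
        (hAD y hy.2).norm).const_mul 2).sinh).div_const 2
      have e : ‖A y‖ * picardWeight A y =
          Real.cosh (2 * ∫ s in (0 : ℝ)..y, ‖A s‖) * (2 * ‖A y‖) / 2 := by
        rw [picardWeight]
        ring
      rw [e]
      exact h)
    ((intervalIntegrable_of_locallyIntegrable (locallyIntegrable_norm hA) _ _).mul_continuousOn (continuous_picardWeight hA).continuousOn)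
  simpa using this

/-- With `F(x) = ∫₀ˣ ‖A‖`, the integrand is at most `C F' cosh(2F)`, whose primitive is `C
sinh(2F)/2`, and `|sinh| ≤ cosh`. The 2 in the weight produces the contraction constant 1/2, and
evenness of `cosh` treats both signs of `x` at once. -/
theorem norm_integral_le_picardWeight (hA : LocallyIntegrable A) {D : Set ℝ} (hD : D.Countable)
    (hAD : ∀ x ∉ D, ContinuousAt A x) {v : ℝ → E} {C : ℝ} (hv : ∀ x, ‖v x‖ ≤ C) (x : ℝ) :
    ‖∫ s in (0 : ℝ)..x, A s (picardWeight A s • v s)‖ ≤ picardWeight A x * (C / 2) := by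
  have hC : 0 ≤ C := (norm_nonneg _).trans (hv 0)
  calc ‖∫ s in (0 : ℝ)..x, A s (picardWeight A s • v s)‖
      ≤ |∫ s in (0 : ℝ)..x, ‖A s‖ * picardWeight A s * C| := by
        refine intervalIntegral.norm_integral_le_abs_of_norm_le
          (Filter.Eventually.of_forall fun s => ?_)
          (((intervalIntegrable_of_locallyIntegrable (locallyIntegrable_norm hA) _ _).mul_continuousOn
            (continuous_picardWeight hA).continuousOn).mul_const C)
        rw [mul_assoc]
        refine (A s).le_opNorm_of_le ?_
        rw [norm_smul, Real.norm_of_nonneg (picardWeight_pos s).le]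
        exact mul_le_mul_of_nonneg_left (hv s) (picardWeight_pos s).le
    _ = |Real.sinh (2 * ∫ s in (0 : ℝ)..x, ‖A s‖)| * (C / 2) := by
        rw [intervalIntegral.integral_mul_const, integral_norm_mul_picardWeight hA hD hAD,
          abs_mul, abs_of_nonneg hC, abs_div, abs_two]
        ring
    _ ≤ picardWeight A x * (C / 2) := by
        refine mul_le_mul_of_nonneg_right ?_ (by positivity)
        rw [picardWeight, Real.abs_sinh, ← Real.cosh_abs (2 * _)]
        exact (Real.sinh_lt_cosh _).le

variable [CompleteSpace E]

/-- Global existence for the linear equation `u' = A u` with a locally integrable coefficient that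
is continuous off a countable set. -/
theorem exists_linear_ode_solution (hA : LocallyIntegrable A) {D : Set ℝ} (hD : D.Countable)
    (hAD : ∀ x ∉ D, ContinuousAt A x) (u₀ : E) :
    ∃ u : ℝ → E, Continuous u ∧ u 0 = u₀ ∧ ∀ x ∉ D, HasDerivAt u (A x (u x)) x := by
  have hω := continuous_picardWeight hA
  have hli : ∀ v : ℝ →ᵇ E, LocallyIntegrable fun s => A s (picardWeight A s • v s) := fun v =>
    locallyIntegrable_clm_apply hA (hω.smul v.continuous)
  -- Substituting `u = picardWeight A • v` turns `u = u₀ + ∫ A u` into a fixed point problem among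
  -- bounded continuous `v` on all of `ℝ`, so no local solutions have to be glued.
  let S : (ℝ →ᵇ E) → (ℝ →ᵇ E) := fun v => BoundedContinuousFunction.ofNormedAddCommGroup
    (fun x => (picardWeight A x)⁻¹ • (u₀ + ∫ s in (0 : ℝ)..x, A s (picardWeight A s • v s)))
    ((hω.inv₀ fun x => (picardWeight_pos x).ne').smul
      (continuous_const.add (continuous_integral_of_locallyIntegrable (hli v) 0)))
    (‖u₀‖ + ‖v‖ / 2) (fun x => by
      have hx := picardWeight_pos (A := A) x
      rw [norm_smul, norm_inv, Real.norm_of_nonneg hx.le, inv_mul_le_iff₀ hx, mul_add]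
      refine (norm_add_le _ _).trans (add_le_add ?_ ?_)
      · exact le_mul_of_one_le_left (norm_nonneg _) (one_le_picardWeight x)
      · exact norm_integral_le_picardWeight hA hD hAD v.norm_coe_le_norm x)
  have hS : ContractingWith (1 / 2) S := by
    refine ⟨by norm_num, LipschitzWith.of_dist_le_mul fun v w => ?_⟩
    refine (BoundedContinuousFunction.dist_le (by positivity)).2 fun x => ?_
    have hx := picardWeight_pos (A := A) x
    have hsub : S v x - S w x = (picardWeight A x)⁻¹ •
        ∫ s in (0 : ℝ)..x, A s (picardWeight A s • (v - w) s) := by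
      simp only [S, BoundedContinuousFunction.coe_ofNormedAddCommGroup,
        BoundedContinuousFunction.coe_sub, Pi.sub_apply, smul_sub, map_sub]
      rw [← smul_sub, add_sub_add_left_eq_sub, intervalIntegral.integral_sub (intervalIntegrable_of_locallyIntegrable (hli v) _ _)
        (intervalIntegrable_of_locallyIntegrable (hli w) _ _)]
    rw [dist_eq_norm, dist_eq_norm, hsub, norm_smul, norm_inv, Real.norm_of_nonneg hx.le,
      inv_mul_le_iff₀ hx]
    refine (norm_integral_le_picardWeight hA hD hAD (v - w).norm_coe_le_norm x).trans
      (le_of_eq ?_)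
    rw [NNReal.coe_div, NNReal.coe_one, NNReal.coe_ofNat]
    ring
  set v := ContractingWith.fixedPoint S hS
  have hv : S v = v := hS.fixedPoint_isFixedPt
  have hu : ∀ x, picardWeight A x • v x =
      u₀ + ∫ s in (0 : ℝ)..x, A s (picardWeight A s • v s) := fun x => by
    conv_lhs => rw [← hv]
    exact smul_inv_smul₀ (picardWeight_pos x).ne' _
  have huc : Continuous fun x => picardWeight A x • v x := hω.smul v.continuous
  refine ⟨fun x => picardWeight A x • v x, huc, ?_, fun x hx => ?_⟩
  · exact (hu 0).trans (by rw [intervalIntegral.integral_same, add_zero])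
  have h := (hasDerivAt_integral_of_locallyIntegrable (hli v) 0
    ((hAD x hx).clm_apply huc.continuousAt)).const_add u₀
  exact h.congr_of_eventuallyEq (Filter.Eventually.of_forall hu)

end LinearODE

/-! ### Locally finite exceptional sets and derivatives off them. -/

theorem FiniteOnIntervals.countable {S : Set ℝ} (hS : FiniteOnIntervals S) : S.Countable := by
  have : S ⊆ ⋃ n : ℕ, S ∩ Icc (-(n : ℝ)) n := fun x hx => by
    obtain ⟨n, hn⟩ := exists_nat_ge |x|
    exact mem_iUnion.2 ⟨n, hx, abs_le.1 hn⟩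
  exact (countable_iUnion fun n => (hS _ _).countable).mono this

theorem FiniteOnIntervals.mono {S T : Set ℝ} (hT : FiniteOnIntervals T) (h : S ⊆ T) :
    FiniteOnIntervals S :=
  fun a b => (hT a b).subset (inter_subset_inter_left _ h)

theorem FiniteOnIntervals.union {S T : Set ℝ} (hS : FiniteOnIntervals S)
    (hT : FiniteOnIntervals T) : FiniteOnIntervals (S ∪ T) := fun a b => by
  rw [union_inter_distrib_right]
  exact (hS a b).union (hT a b)

theorem finiteOnIntervals_empty : FiniteOnIntervals ∅ := fun a b => by simp

/-- A continuous function that has a continuous derivative off a countable set is differentiable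
everywhere. -/
theorem hasDerivAt_of_off_countable {f g : ℝ → ℂ} (hf : Continuous f) (hg : Continuous g)
    {S : Set ℝ} (hS : S.Countable) (h : ∀ x ∉ S, HasDerivAt f (g x) x) (x : ℝ) :
    HasDerivAt f (g x) x := by
  have key : ∀ y, f y = f 0 + ∫ s in (0 : ℝ)..y, g s := fun y => by
    rw [integral_eq_of_hasDerivAt_off_countable f g hS hf.continuousOn (fun z hz => h z hz.2)
      (hg.intervalIntegrable _ _)]
    ring
  exact ((hasDerivAt_integral_of_locallyIntegrable hg.locallyIntegrable 0
    hg.continuousAt).const_add (f 0)).congr_of_eventuallyEq (Filter.Eventually.of_forall key)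

theorem eq_of_hasDerivAt_zero_off_countable {f : ℝ → ℂ} (hf : Continuous f)
    {S : Set ℝ} (hS : S.Countable) (h : ∀ x ∉ S, HasDerivAt f 0 x) (x y : ℝ) : f x = f y :=
  is_const_of_deriv_eq_zero
    (fun z => (hasDerivAt_of_off_countable hf continuous_zero hS h z).differentiableAt)
    (fun z => (hasDerivAt_of_off_countable hf continuous_zero hS h z).deriv) x y

/-! ### Closure properties of the classes `C_p^l`. -/

section Cp

theorem isCp_zero_of_continuous {f : ℝ → ℂ} (hf : Continuous f) : IsCp 0 f :=
  ⟨hf.locallyIntegrable, finiteOnIntervals_empty.mono fun _ hx => hx hf.continuousAt⟩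

theorem locallyIntegrable_continuous_mul {f e : ℝ → ℂ} (he : Continuous e)
    (hf : LocallyIntegrable f) : LocallyIntegrable fun x => e x * f x := by
  have := locallyIntegrable_clm_apply (A := fun s => f s • ContinuousLinearMap.id ℝ ℂ)
    (fun x => by
      obtain ⟨U, hU, h⟩ := hf x
      exact ⟨U, hU, Integrable.smul_const h _⟩) he
  simpa [mul_comm] using this

theorem IsCp.continuous_mul_zero {f e : ℝ → ℂ} (he : Continuous e) (hf : IsCp 0 f) :
    IsCp 0 fun x => e x * f x :=
  ⟨locallyIntegrable_continuous_mul he hf.1,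
    hf.2.mono fun _ hx hc => hx (he.continuousAt.mul hc)⟩

theorem IsCp.add {l : ℕ} : ∀ {f g : ℝ → ℂ}, IsCp l f → IsCp l g → IsCp l fun x => f x + g x := by
  induction l with
  | zero =>
    intro f g hf hg
    refine ⟨hf.1.add hg.1, (hf.2.union hg.2).mono fun x hx => ?_⟩
    by_contra hc
    simp only [mem_union, mem_ofPred_eq, not_or, not_not] at hc
    exact hx (hc.1.add hc.2)
  | succ l ih =>
    rintro f g ⟨hf, f', hf', S, hS, hfS⟩ ⟨hg, g', hg', T, hT, hgT⟩
    exact ⟨hf.add hg, _, ih hf' hg', S ∪ T, hS.union hT, fun x hx =>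
      (hfS x fun h => hx (Or.inl h)).add (hgT x fun h => hx (Or.inr h))⟩

theorem IsCp.of_succ {l : ℕ} : ∀ {f : ℝ → ℂ}, IsCp (l + 1) f → IsCp l f := by
  induction l with
  | zero => exact fun hf => isCp_zero_of_continuous hf.1
  | succ l ih =>
    rintro f ⟨hf, f', hf', hS⟩
    exact ⟨hf, f', ih hf', hS⟩

theorem hasDerivAt_planeWave (k : ℂ) (x : ℝ) :
    HasDerivAt (planeWave k) (planeWave k x * (Complex.I * k)) x := by
  have h : HasDerivAt (fun y : ℝ => Complex.I * k * (y : ℂ)) (Complex.I * k * 1) x :=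
    (Complex.ofRealCLM.hasDerivAt (x := x)).const_mul (Complex.I * k)
  rw [mul_one] at h
  exact h.cexp

theorem continuous_planeWave (k : ℂ) : Continuous (planeWave k) :=
  continuous_iff_continuousAt.2 fun x => (hasDerivAt_planeWave k x).continuousAt

/-- Differentiating the plane wave yields a factor `ik`; the free constant `c` absorbs it, so that
the induction on `l` closes. -/
theorem IsCp.planeWave_mul (k : ℂ) {l : ℕ} : ∀ {f : ℝ → ℂ} (c : ℂ), IsCp l f →
    IsCp l fun x => planeWave k x * c * f x := by
  induction l with
  | zero => exact fun c hf => hf.continuous_mul_zero ((continuous_planeWave k).mul_const c)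
  | succ l ih =>
    rintro f c hf
    have hf0 := hf.of_succ
    obtain ⟨hf, f', hf', S, hS, hfS⟩ := hf
    refine ⟨((continuous_planeWave k).mul_const c).mul hf, _,
      (ih (Complex.I * k * c) hf0).add (ih c hf'), S, hS, fun x hx => ?_⟩
    have h := ((hasDerivAt_planeWave k x).mul_const c).mul (hfS x hx)
    rw [mul_assoc (planeWave k x)] at h
    exact h

end Cp

/-! ### Solutions of the equation: existence, Wronskian, uniqueness. -/

/-- `ψ` is a continuously differentiable solution with derivative `ψ'`, the equation holding off
the discontinuities of `V`. -/
structure IsSolutionPair (W V : ℝ → ℂ) (lam : ℝ) (ψ ψ' : ℝ → ℂ) : Prop where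
  continuous_deriv : Continuous ψ'
  hasDerivAt : ∀ x, HasDerivAt ψ (ψ' x) x
  hasDerivAt_deriv : ∀ x, ContinuousAt V x →
    HasDerivAt ψ' (W x * ψ' x + (V x - lam) * ψ x) x

section Solutions

variable {W V : ℝ → ℂ} {lam : ℝ}

theorem IsSolutionPair.continuous {ψ ψ' : ℝ → ℂ} (h : IsSolutionPair W V lam ψ ψ') :
    Continuous ψ :=
  continuous_iff_continuousAt.2 fun x => (h.hasDerivAt x).continuousAt

theorem IsSolution.exists_pair {ψ : ℝ → ℂ} (hW : Continuous W) (h : IsSolution W V lam ψ) :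
    ∃ ψ', IsSolutionPair W V lam ψ ψ' := by
  obtain ⟨⟨hψ, g, hg, S, hS, hψS⟩, heq⟩ := h
  have hd := hasDerivAt_of_off_countable hψ hg.1 hS.countable hψS
  have hdg : deriv ψ = g := funext fun x => (hd x).deriv
  refine ⟨g, hg.1, hd, fun x hx => ?_⟩
  obtain ⟨h1, h2⟩ := heq x hW.continuousAt hx
  rw [slOp, hdg] at h2
  rw [hdg] at h1
  have e : W x * g x + (V x - lam) * ψ x = deriv g x := by linear_combination h2
  rw [e]
  exact h1.hasDerivAt

theorem IsSolutionPair.isSolution {ψ ψ' : ℝ → ℂ} (hW : Continuous W) (hV : IsCp 0 V)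
    (h : IsSolutionPair W V lam ψ ψ') : IsSolution W V lam ψ := by
  have hdg : deriv ψ = ψ' := funext fun x => (h.hasDerivAt x).deriv
  refine ⟨⟨h.continuous, ψ', ⟨h.continuous_deriv, fun x => W x * ψ' x + (V x - lam) * ψ x, ?_,
    _, hV.2, fun x hx => h.hasDerivAt_deriv x (not_not.1 hx)⟩, ∅, finiteOnIntervals_empty,
    fun x _ => h.hasDerivAt x⟩, fun x _ hx => ?_⟩
  · have h1 : IsCp 0 fun x => ψ x * (V x + -(lam : ℂ)) :=
      (hV.add (isCp_zero_of_continuous continuous_const)).continuous_mul_zero h.continuous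
    have h2 := (isCp_zero_of_continuous (hW.mul h.continuous_deriv)).add h1
    convert h2 using 2
    simp only [Pi.mul_apply]
    ring
  · have hd := h.hasDerivAt_deriv x hx
    rw [slOp, hdg, hd.deriv]
    exact ⟨hd.differentiableAt, by ring⟩

theorem IsSolutionPair.lincomb {φ φ' χ χ' : ℝ → ℂ} (hφ : IsSolutionPair W V lam φ φ')
    (hχ : IsSolutionPair W V lam χ χ') (a b : ℂ) :
    IsSolutionPair W V lam (fun x => a * φ x + b * χ x) (fun x => a * φ' x + b * χ' x) where
  continuous_deriv :=
    (continuous_const.mul hφ.continuous_deriv).add (continuous_const.mul hχ.continuous_deriv)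
  hasDerivAt x := ((hφ.hasDerivAt x).const_mul a).add ((hχ.hasDerivAt x).const_mul b)
  hasDerivAt_deriv x hx := by
    refine (((hφ.hasDerivAt_deriv x hx).const_mul a).add
      ((hχ.hasDerivAt_deriv x hx).const_mul b)).congr_deriv ?_
    ring

theorem IsSolutionPair.shift {γ : ℝ} (hW : Function.Periodic W γ) (hV : Function.Periodic V γ)
    {φ φ' : ℝ → ℂ} (hφ : IsSolutionPair W V lam φ φ') :
    IsSolutionPair W V lam (fun x => φ (x + γ)) (fun x => φ' (x + γ)) where
  continuous_deriv := hφ.continuous_deriv.comp (continuous_id.add continuous_const)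
  hasDerivAt x := (hφ.hasDerivAt (x + γ)).comp_add_const x γ
  hasDerivAt_deriv x hx := by
    have hV' : (fun y => V (y - γ)) = V := funext hV.sub_eq
    have hx' : ContinuousAt V (x + γ) := by
      rw [← hV']
      refine ContinuousAt.comp (f := fun y => y - γ) (g := V) ?_
        (continuous_id.sub continuous_const).continuousAt
      simpa using hx
    have h := (hφ.hasDerivAt_deriv (x + γ) hx').comp_add_const x γ
    rwa [hW x, hV x] at h

theorem exists_solutionPair (hW : Continuous W) (hV : IsCp 0 V) (a b : ℂ) :
    ∃ ψ ψ', IsSolutionPair W V lam ψ ψ' ∧ ψ 0 = a ∧ ψ' 0 = b := by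
  have hD := hV.2.countable
  have hs : ∀ {f : ℝ → ℂ} (c : ℂ × ℂ →L[ℝ] ℂ × ℂ), LocallyIntegrable f →
      LocallyIntegrable fun x => f x • c := fun c hf x => by
    obtain ⟨U, hU, h⟩ := hf x
    exact ⟨U, hU, Integrable.smul_const h _⟩
  -- The companion system `(ψ, ψ')' = (ψ', Wψ' + (V - λ)ψ)`, split into constant operators with
  -- scalar coefficients `1`, `W`, `V - λ`.
  let B₁ : ℂ × ℂ →L[ℝ] ℂ × ℂ :=
    (ContinuousLinearMap.inl ℝ ℂ ℂ).comp (ContinuousLinearMap.snd ℝ ℂ ℂ)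
  let B₂ : ℂ × ℂ →L[ℝ] ℂ × ℂ :=
    (ContinuousLinearMap.inr ℝ ℂ ℂ).comp (ContinuousLinearMap.snd ℝ ℂ ℂ)
  let B₃ : ℂ × ℂ →L[ℝ] ℂ × ℂ :=
    (ContinuousLinearMap.inr ℝ ℂ ℂ).comp (ContinuousLinearMap.fst ℝ ℂ ℂ)
  obtain ⟨u, hu, hu0, hu'⟩ := exists_linear_ode_solution
    (A := fun x => B₁ + W x • B₂ + (V x - lam) • B₃)
    (((locallyIntegrable_const B₁).add (hs B₂ hW.locallyIntegrable)).add
      (hs B₃ (hV.1.sub (locallyIntegrable_const (lam : ℂ))))) hD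
    (fun x hx => (continuousAt_const.add (hW.continuousAt.smul continuousAt_const)).add
      (((not_not.1 hx : ContinuousAt V x).sub continuousAt_const).smul continuousAt_const)) (a, b)
  have h1 : ∀ x ∉ {x | ¬ ContinuousAt V x}, HasDerivAt (fun y => (u y).1) (u x).2 x :=
    fun x hx => by
      have := (ContinuousLinearMap.fst ℝ ℂ ℂ).hasFDerivAt.comp_hasDerivAt x (hu' x hx)
      simpa [B₁, B₂, B₃, Function.comp_def] using this
  refine ⟨fun x => (u x).1, fun x => (u x).2, ⟨hu.snd,
    hasDerivAt_of_off_countable hu.fst hu.snd hD h1, fun x hx => ?_⟩, by simp [hu0], by simp [hu0]⟩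
  have := (ContinuousLinearMap.snd ℝ ℂ ℂ).hasFDerivAt.comp_hasDerivAt x (hu' x (not_not.2 hx))
  simpa [B₁, B₂, B₃, Function.comp_def] using this

/-- Liouville's formula for the Wronskian. -/
theorem wronskian_eq (hW : Continuous W) (hV : IsCp 0 V) {φ φ' χ χ' : ℝ → ℂ}
    (hφ : IsSolutionPair W V lam φ φ') (hχ : IsSolutionPair W V lam χ χ') (x : ℝ) :
    φ x * χ' x - χ x * φ' x =
      (φ 0 * χ' 0 - χ 0 * φ' 0) * Complex.exp (∫ s in (0 : ℝ)..x, W s) := by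
  have hP : ∀ y, HasDerivAt (fun z => ∫ s in (0 : ℝ)..z, W s) (W y) y := fun y =>
    hasDerivAt_integral_of_locallyIntegrable hW.locallyIntegrable 0 hW.continuousAt
  have hPc := continuous_integral_of_locallyIntegrable hW.locallyIntegrable 0
  -- The Wronskian `w` satisfies `w' = W w` off the discontinuities of `V`, so `w · exp(-∫W)` is
  -- constant.
  have h := eq_of_hasDerivAt_zero_off_countable
    (f := fun y => (φ y * χ' y - χ y * φ' y) * Complex.exp (-∫ s in (0 : ℝ)..y, W s))
    (((hφ.continuous.mul hχ.continuous_deriv).sub (hχ.continuous.mul hφ.continuous_deriv)).mul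
      (Complex.continuous_exp.comp hPc.neg)) hV.2.countable (fun y hy => by
        have hy' : ContinuousAt V y := not_not.1 hy
        have h1 := (((hφ.hasDerivAt y).mul (hχ.hasDerivAt_deriv y hy')).sub
          ((hχ.hasDerivAt y).mul (hφ.hasDerivAt_deriv y hy'))).mul (hP y).neg.cexp
        refine h1.congr_deriv ?_
        simp only [Pi.mul_apply, Pi.sub_apply, Pi.neg_apply]
        ring) x 0
  simp only [intervalIntegral.integral_same, neg_zero, Complex.exp_zero, mul_one] at h
  rw [← h, mul_assoc, ← Complex.exp_add, neg_add_cancel, Complex.exp_zero, mul_one]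

/-- With `w(f,g) = f g' - g f'`, the identity `ψ w(φ,χ) = φ w(ψ,χ) - χ w(ψ,φ)` holds, and likewise
with `ψ', φ', χ'` as the outer factors. Zero initial data annihilate the right side, while `w(φ,χ)`
is an exponential. -/
theorem IsSolutionPair.eq_zero (hW : Continuous W) (hV : IsCp 0 V) {ψ ψ' : ℝ → ℂ}
    (h : IsSolutionPair W V lam ψ ψ') (h0 : ψ 0 = 0) (h0' : ψ' 0 = 0) (x : ℝ) :
    ψ x = 0 ∧ ψ' x = 0 := by
  obtain ⟨φ, φ', hφ, hφ0, hφ0'⟩ := exists_solutionPair (lam := lam) hW hV 1 0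
  obtain ⟨χ, χ', hχ, hχ0, hχ0'⟩ := exists_solutionPair (lam := lam) hW hV 0 1
  have h1 := wronskian_eq hW hV h hφ x
  have h2 := wronskian_eq hW hV h hχ x
  have h3 := wronskian_eq hW hV hφ hχ x
  rw [h0, h0'] at h1 h2
  rw [hφ0, hφ0', hχ0, hχ0'] at h3
  have he := Complex.exp_ne_zero (∫ s in (0 : ℝ)..x, W s)
  refine ⟨mul_left_cancel₀ he ?_, mul_left_cancel₀ he ?_⟩
  · linear_combination φ x * h2 - χ x * h1 - ψ x * h3
  · linear_combination φ' x * h2 - χ' x * h1 - ψ' x * h3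

end Solutions

/-! ### Floquet multipliers and their correspondence with quasimomenta. -/

/-- `ρ` is a Floquet multiplier of `ℒψ = λψ`. -/
def IsMultiplier (γ : ℝ) (W V : ℝ → ℂ) (lam : ℝ) (ρ : ℂ) : Prop :=
  ∃ ψ, IsSolution W V lam ψ ∧ ψ ≠ 0 ∧ ∀ x, ψ (x + γ) = ρ * ψ x

section Multipliers

variable {γ : ℝ} {W V : ℝ → ℂ} {lam : ℝ}

/-- The Floquet multipliers are the roots of a quadratic polynomial with constant term
`exp (∫₀^γ W)`, the determinant of the monodromy matrix. -/
theorem exists_isMultiplier_iff (hW : Continuous W) (hWp : Function.Periodic W γ)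
    (hV : IsCpPer γ 0 V) :
    ∃ t : ℂ, ∀ ρ, IsMultiplier γ W V lam ρ ↔
      ρ ^ 2 - t * ρ + Complex.exp (∫ s in (0 : ℝ)..γ, W s) = 0 := by
  obtain ⟨φ, φ', hφ, hφ0, hφ0'⟩ := exists_solutionPair (lam := lam) hW hV.1 1 0
  obtain ⟨χ, χ', hχ, hχ0, hχ0'⟩ := exists_solutionPair (lam := lam) hW hV.1 0 1
  have hw := wronskian_eq hW hV.1 hφ hχ γ
  rw [hφ0, hφ0', hχ0, hχ0'] at hw
  refine ⟨φ γ + χ' γ, fun ρ => ⟨?_, fun hρ => ?_⟩⟩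
  · rintro ⟨ψ, hψ, hne, hper⟩
    obtain ⟨ψ', hp⟩ := hψ.exists_pair hW
    have hper' : ψ' γ = ρ * ψ' 0 := by
      have h1 := (hp.hasDerivAt (0 + γ)).comp_add_const 0 γ
      have h2 := (hp.hasDerivAt 0).const_mul ρ
      simp only [hper] at h1
      simpa using h1.unique h2
    have hperγ : ψ γ = ρ * ψ 0 := by simpa using hper 0
    -- By uniqueness `ψ = ψ(0)φ + ψ'(0)χ`; at `γ` this makes the initial data of `ψ` an eigenvector
    -- of the monodromy matrix.
    have hd := ((hp.lincomb (hφ.lincomb hχ (ψ 0) (ψ' 0)) 1 (-1)).eq_zero hW hV.1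
      (by simp [hφ0, hχ0]) (by simp [hφ0', hχ0']) γ)
    have e1 : (φ γ - ρ) * ψ 0 + χ γ * ψ' 0 = 0 := by linear_combination hperγ - hd.1
    have e2 : φ' γ * ψ 0 + (χ' γ - ρ) * ψ' 0 = 0 := by linear_combination hper' - hd.2
    -- If the characteristic polynomial does not vanish at `ρ`, Cramer's rule forces the initial
    -- data, hence `ψ`, to be zero.
    by_contra hcon
    refine hne (funext fun x => (hp.eq_zero hW hV.1 ?_ ?_ x).1)
    · exact mul_left_cancel₀ hcon
        (by linear_combination (χ' γ - ρ) * e1 - χ γ * e2 - ψ 0 * hw)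
    · exact mul_left_cancel₀ hcon
        (by linear_combination (φ γ - ρ) * e2 - φ' γ * e1 - ψ' 0 * hw)
  · obtain ⟨v, hv, hMv⟩ := (Matrix.exists_mulVec_eq_zero_iff
      (M := !![φ γ - ρ, χ γ; φ' γ, χ' γ - ρ])).2 (by
        rw [Matrix.det_fin_two_of]
        linear_combination hρ + hw)
    have e1 : (φ γ - ρ) * v 0 + χ γ * v 1 = 0 := by
      simpa [Matrix.mulVec, dotProduct, Fin.sum_univ_two] using congrFun hMv 0
    have e2 : φ' γ * v 0 + (χ' γ - ρ) * v 1 = 0 := by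
      simpa [Matrix.mulVec, dotProduct, Fin.sum_univ_two] using congrFun hMv 1
    have hp := hφ.lincomb hχ (v 0) (v 1)
    refine ⟨_, hp.isSolution hW hV.1, fun h0 => hv ?_, fun x => ?_⟩
    · have h0' : v 0 * φ' 0 + v 1 * χ' 0 = 0 := by
        have := hp.hasDerivAt 0
        rw [h0] at this
        exact this.unique (hasDerivAt_const (0 : ℝ) (0 : ℂ))
      have h00 := congrFun h0 0
      funext i
      fin_cases i
      · simpa [hφ0, hχ0] using h00
      · simpa [hφ0', hχ0'] using h0'
    -- The solution `ψ(· + γ) - ρψ` has zero initial data by the eigenvector equations.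
    · have := (((hp.shift hWp hV.2).lincomb hp 1 (-ρ)).eq_zero hW hV.1
        (by simp only [zero_add, hφ0, hχ0]; linear_combination e1)
        (by simp only [zero_add, hφ0', hχ0']; linear_combination e2) x).1
      linear_combination this

theorem planeWave_ne_zero (k : ℂ) (x : ℝ) : planeWave k x ≠ 0 := Complex.exp_ne_zero _

theorem planeWave_add (k : ℂ) (x y : ℝ) : planeWave k (x + y) = planeWave k x * planeWave k y := by
  rw [planeWave, planeWave, planeWave, ← Complex.exp_add]
  push_cast
  ring_nf

theorem planeWave_neg_mul (k : ℂ) (x : ℝ) : planeWave (-k) x * planeWave k x = 1 := by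
  rw [planeWave, planeWave, ← Complex.exp_add, ← Complex.exp_zero]
  ring_nf

theorem exists_planeWave_eq (hγ : γ ≠ 0) {ρ : ℂ} (hρ : ρ ≠ 0) : ∃ k, planeWave k γ = ρ := by
  refine ⟨Complex.log ρ / (Complex.I * γ), ?_⟩
  have : (γ : ℂ) ≠ 0 := Complex.ofReal_ne_zero.2 hγ
  rw [planeWave]
  convert Complex.exp_log hρ using 2
  field_simp

/-- The kernel of `k ↦ e^{ikγ}` is `(2π/γ)ℤ`, so equality of classes becomes equality of complex
numbers. -/
theorem kClass_eq_iff (hγ : γ ≠ 0) (k k' : ℂ) :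
    kClass γ k = kClass γ k' ↔ planeWave k γ = planeWave k' γ := by
  have hγ' : (γ : ℂ) ≠ 0 := Complex.ofReal_ne_zero.2 hγ
  rw [kClass, kClass, QuotientAddGroup.eq, AddSubgroup.mem_zmultiples_iff, planeWave, planeWave,
    eq_comm (a := Complex.exp _), Complex.exp_eq_exp_iff_exists_int]
  refine exists_congr fun n => ?_
  rw [zsmul_eq_mul]
  push_cast
  constructor
  · intro h
    have : k' = k + n * (2 * Real.pi / γ) := by linear_combination -h
    rw [this]
    field_simp
  · intro h
    have : Complex.I * γ * k' = Complex.I * γ * (k + n * (2 * Real.pi / γ)) := by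
      have e : (γ : ℂ) * (2 * Real.pi / γ) = 2 * Real.pi := mul_div_cancel₀ _ hγ'
      linear_combination h - Complex.I * n * e
    linear_combination -mul_left_cancel₀ (mul_ne_zero Complex.I_ne_zero hγ') this

theorem mem_quasiClasses_iff (hγ : γ ≠ 0) (hW : Continuous W) (hWp : Function.Periodic W γ)
    (hV : IsCpPer γ 0 V) (k : ℂ) :
    kClass γ k ∈ quasiClasses γ W V lam ↔ IsMultiplier γ W V lam (planeWave k γ) := by
  constructor
  · rintro ⟨ψ, κ, hψ, hκ, hkκ⟩
    rw [(kClass_eq_iff hγ k κ).1 hkκ]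
    obtain ⟨ψ', hp⟩ := hψ.exists_pair hW
    -- The operator `ψ ↦ ψ(· + γ) - μψ` preserves solutions. With `μ = e^{iκγ}` it leaves only the
    -- `p₂` part of the growth form; with `μ = e^{ik'γ}` it removes the second term of the
    -- combination form. A Bloch solution with multiplier `e^{iκγ}` remains.
    have hsub : ∀ μ : ℂ, IsSolution W V lam fun x => 1 * ψ (x + γ) + -μ * ψ x := fun μ =>
      ((hp.shift hWp hV.2).lincomb hp 1 (-μ)).isSolution hW hV.1
    rcases hκ with ⟨p, hp0, hpp, hψp⟩ | ⟨p₁, p₂, h₁, h₂, hp0, hψp⟩ |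
      ⟨k', p₁, p₂, hp₁, -, hkk', h₁, h₂, hψp⟩
    · refine ⟨ψ, hψ, fun h => hp0 (funext fun x => ?_), fun x => ?_⟩
      · have := congrFun h x
        rw [hψp] at this
        exact (mul_eq_zero.1 this).resolve_left (planeWave_ne_zero κ x)
      · rw [hψp, hψp, planeWave_add, hpp.2 x]
        ring
    · have key : ∀ x, 1 * ψ (x + γ) + -planeWave κ γ * ψ x =
          planeWave κ γ * γ * (planeWave κ x * p₂ x) := fun x => by
        rw [hψp, hψp, planeWave_add, h₁.2 x, h₂.2 x]
        push_cast
        ring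
      refine ⟨_, hsub (planeWave κ γ), fun h => hp0 (funext fun x => ?_), fun x => ?_⟩
      · have := congrFun h x
        rw [key] at this
        simpa [planeWave_ne_zero, hγ] using this
      · rw [key, key, planeWave_add, h₂.2 x]
        ring
    · have hne : planeWave κ γ - planeWave k' γ ≠ 0 :=
        sub_ne_zero.2 fun h => hkk' ((kClass_eq_iff hγ _ _).2 h)
      have key : ∀ x, 1 * ψ (x + γ) + -planeWave k' γ * ψ x =
          (planeWave κ γ - planeWave k' γ) * (planeWave κ x * p₁ x) := fun x => by
        rw [hψp, hψp, planeWave_add, planeWave_add, h₁.2 x, h₂.2 x]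
        ring
      refine ⟨_, hsub (planeWave k' γ), fun h => hp₁ (funext fun x => ?_), fun x => ?_⟩
      · have := congrFun h x
        rw [key] at this
        simpa [planeWave_ne_zero, hne] using this
      · rw [key, key, planeWave_add, h₁.2 x]
        ring
  · rintro ⟨ψ, hψ, hne, hper⟩
    have hrep : ∀ x, ψ x = planeWave k x * (planeWave (-k) x * 1 * ψ x) := fun x => by
      linear_combination -ψ x * planeWave_neg_mul k x
    refine ⟨ψ, k, hψ, Or.inl ⟨fun x => planeWave (-k) x * 1 * ψ x, fun h => hne (funext fun x => ?_),
      ⟨hψ.1.planeWave_mul (-k) 1, fun x => ?_⟩, hrep⟩, rfl⟩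
    · rw [hrep, congrFun h x]
      simp
    · change planeWave (-k) (x + γ) * 1 * ψ (x + γ) = planeWave (-k) x * 1 * ψ x
      rw [planeWave_add, hper]
      linear_combination planeWave (-k) x * ψ x * planeWave_neg_mul k γ

/-- If all quasimomenta are congruent to `k₀`, then `exp (i k₀ γ)` is a double multiplier. -/
theorem planeWave_sq_of_quasiClasses_eq_singleton (hγ : γ ≠ 0) (hW : Continuous W)
    (hWp : Function.Periodic W γ) (hV : IsCpPer γ 0 V) {k₀ : ℂ}
    (h : quasiClasses γ W V lam = {kClass γ k₀}) :
    planeWave k₀ γ ^ 2 = Complex.exp (∫ s in (0 : ℝ)..γ, W s) := by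
  obtain ⟨t, ht⟩ := exists_isMultiplier_iff (lam := lam) hW hWp hV
  have h0 : planeWave k₀ γ ^ 2 - t * planeWave k₀ γ + Complex.exp (∫ s in (0 : ℝ)..γ, W s) = 0 :=
    (ht _).1 ((mem_quasiClasses_iff hγ hW hWp hV k₀).1 (by rw [h]; rfl))
  have hprod : planeWave k₀ γ * (t - planeWave k₀ γ) = Complex.exp (∫ s in (0 : ℝ)..γ, W s) := by
    linear_combination -h0
  -- The second root is nonzero because the product of the roots is an exponential; it therefore has
  -- a quasimomentum, whose class must be that of `k₀`.
  have hne : t - planeWave k₀ γ ≠ 0 := fun hz =>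
    Complex.exp_ne_zero (∫ s in (0 : ℝ)..γ, W s) (by rw [← hprod, hz, mul_zero])
  obtain ⟨k, hk⟩ := exists_planeWave_eq hγ hne
  have hmem : kClass γ k ∈ quasiClasses γ W V lam :=
    (mem_quasiClasses_iff hγ hW hWp hV k).2 ((ht _).2 (by rw [hk]; linear_combination h0))
  rw [h, Set.mem_singleton_iff, kClass_eq_iff hγ, hk] at hmem
  rw [← hprod, hmem, sq]

theorem planeWave_mul_of_quasiClasses_eq_pair (hγ : γ ≠ 0) (hW : Continuous W)
    (hWp : Function.Periodic W γ) (hV : IsCpPer γ 0 V) {k₁ k₂ : ℂ}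
    (hne : kClass γ k₁ ≠ kClass γ k₂)
    (h : quasiClasses γ W V lam = {kClass γ k₁, kClass γ k₂}) :
    planeWave k₁ γ * planeWave k₂ γ = Complex.exp (∫ s in (0 : ℝ)..γ, W s) := by
  obtain ⟨t, ht⟩ := exists_isMultiplier_iff (lam := lam) hW hWp hV
  have h1 := (ht _).1 ((mem_quasiClasses_iff hγ hW hWp hV k₁).1 (by rw [h]; exact Or.inl rfl))
  have h2 := (ht _).1 ((mem_quasiClasses_iff hγ hW hWp hV k₂).1 (by rw [h]; exact Or.inr rfl))
  have hne' : planeWave k₁ γ - planeWave k₂ γ ≠ 0 :=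
    sub_ne_zero.2 fun e => hne ((kClass_eq_iff hγ _ _).2 e)
  refine mul_left_cancel₀ hne' ?_
  -- This combination of the two quadratic equations eliminates the trace `t`.
  linear_combination planeWave k₂ γ * h1 - planeWave k₁ γ * h2

end Multipliers

/-! ### From multipliers back to classes in terms of the mean of `W`. -/

theorem exp_integral_eq_planeWave {γ : ℝ} (hγ : γ ≠ 0) (W : ℝ → ℂ) :
    Complex.exp (∫ s in (0 : ℝ)..γ, W s) = planeWave (1 / Complex.I * periodMean γ W) γ := by
  have : (γ : ℂ) ≠ 0 := Complex.ofReal_ne_zero.2 hγ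
  rw [planeWave, periodMean]
  congr 1
  field_simp

theorem planeWave_add_left (k k' : ℂ) (x : ℝ) :
    planeWave (k + k') x = planeWave k x * planeWave k' x := by
  rw [planeWave, planeWave, planeWave, ← Complex.exp_add]
  ring_nf

theorem planeWave_pi_div {γ : ℝ} (hγ : γ ≠ 0) :
    planeWave ((Real.pi : ℂ) / (γ : ℂ)) γ = -1 := by
  have : (γ : ℂ) ≠ 0 := Complex.ofReal_ne_zero.2 hγ
  rw [planeWave, ← Complex.exp_pi_mul_I]
  congr 1
  field_simp

/-- A class whose double is `[2κ]` is `[κ]` or `[κ + π/γ]`. -/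
theorem kClass_eq_or_of_planeWave_sq {γ : ℝ} (hγ : γ ≠ 0) {k κ : ℂ}
    (h : planeWave k γ ^ 2 = planeWave κ γ ^ 2) :
    kClass γ k = kClass γ κ ∨ kClass γ k = kClass γ (κ + (Real.pi : ℂ) / (γ : ℂ)) := by
  rw [kClass_eq_iff hγ, kClass_eq_iff hγ, planeWave_add_left, planeWave_pi_div hγ, mul_neg_one]
  exact sq_eq_sq_iff_eq_or_eq_neg.1 h

end PeriodicSL

theorem mainTheorem4 (γ : ℝ) (hγ : 0 < γ) (W V : ℝ → ℂ)
    (hWcont : Continuous W) (hWper : Function.Periodic W γ)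
    (hV : PeriodicSL.IsCpPer γ 0 V) (lam : ℝ) :
    (lam ∈ PeriodicSL.sigma1 γ W V ∪ PeriodicSL.sigma2 γ W V →
      PeriodicSL.quasiClasses γ W V lam =
          {PeriodicSL.kClass γ (1 / (2 * Complex.I) * PeriodicSL.periodMean γ W)} ∨
      PeriodicSL.quasiClasses γ W V lam =
          {PeriodicSL.kClass γ (1 / (2 * Complex.I) * PeriodicSL.periodMean γ W
            + (Real.pi : ℂ) / (γ : ℂ))}) ∧
    (lam ∈ PeriodicSL.sigma3 γ W V →
      ∃ k₁ k₂ : ℂ, PeriodicSL.kClass γ k₁ ≠ PeriodicSL.kClass γ k₂ ∧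
        PeriodicSL.quasiClasses γ W V lam = {PeriodicSL.kClass γ k₁, PeriodicSL.kClass γ k₂} ∧
        PeriodicSL.kClass γ (k₁ + k₂) =
          PeriodicSL.kClass γ (1 / Complex.I * PeriodicSL.periodMean γ W)) := by
  open PeriodicSL in
  have hγ0 := hγ.ne'
  have hsingle : ∀ k₀, quasiClasses γ W V lam = {kClass γ k₀} →
      quasiClasses γ W V lam = {kClass γ (1 / (2 * Complex.I) * periodMean γ W)} ∨
      quasiClasses γ W V lam = {kClass γ (1 / (2 * Complex.I) * periodMean γ W
        + (Real.pi : ℂ) / (γ : ℂ))} := fun k₀ h => by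
    have hsq := planeWave_sq_of_quasiClasses_eq_singleton hγ0 hWcont hWper hV h
    -- Halving the exponent exhibits `exp ∫₀^γ W` as the square of `e^{iκγ}` with `κ = W̄/(2i)`.
    have hhalf : 1 / Complex.I * periodMean γ W = 1 / (2 * Complex.I) * periodMean γ W +
        1 / (2 * Complex.I) * periodMean γ W := by
      field_simp
      ring
    rw [exp_integral_eq_planeWave hγ0, hhalf, planeWave_add_left, ← sq] at hsq
    rw [h]
    exact (kClass_eq_or_of_planeWave_sq hγ0 hsq).imp (congrArg _) (congrArg _)
  refine ⟨?_, ?_⟩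
  · rintro (⟨ψ, -, -, k₀, h, -⟩ | ⟨ψ, -, -, k₀, h, -⟩) <;> exact hsingle k₀ h
  · rintro ⟨ψ, -, -, k₁, k₂, h, p₁, p₂, hne, -⟩
    refine ⟨k₁, k₂, hne, h, ?_⟩
    rw [kClass_eq_iff hγ0, planeWave_add_left, ← exp_integral_eq_planeWave hγ0]
    exact planeWave_mul_of_quasiClasses_eq_pair hγ0 hWcont hWper hV hne h
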